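/- Let $d\ge 2$, $k\ge 0$, and let $\mathcal{T}_h$ be a conforming simplicial mesh in $\mathbb{R}^d$, i.e. a finite set of nondegenerate closed $d$-simplices (cells) $K$, any two of which meet in the convex hull of their common vertices. Let $\Omega$ be the interior of $\bigcup_{K\in\mathcal{T}_h}K$, let $\mathcal{F}_h$ be the set of all faces (facets) of the cells, and let $\Gamma^0=\bigcup_{F\in\mathcal{F}_h}F$, with $(d-1)$-dimensional surface measure $ds$. For each $F\in\mathcal{F}_h$ let $h_F>0$ be a given number (for instance, the diameter of $F$). Let $$V_h=\{v_h\in L^2(\Omega)^d : v_h|_K\in P_k(K)^d \ \ \forall K\in\mathcal{T}_h\},\qquad \bar Q_h=\{\bar q_h\in L^2(\Gamma^0) : \bar q_h|_F\in P_k(F)\ \ \forall F\in\mathcal{F}_h\},$$ where $P_k$ denotes the polynomials of degree at most $k$. With $n$ the outward unit normal on $\partial K$ and $v^{\pm}$, $n^{\pm}$ the trace and the outward unit normal from the side of $K^{\pm}$, let $[\![v\cdot n]\!]=v^+\cdot n^++v^-\cdot n^-$ on a face shared by two cells $K^+,K^-$, and $[\![v\cdot n]\!]=v\cdot n$ on a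 face that belongs to only one cell. Define $$d_h(u,v)=\sum_{F\in\mathcal{F}_h}\int_F h_F^{-1}[\![u\cdot n]\!]\,[\![v\cdot n]\!]\,ds,\qquad b_2(\bar q,v)=\sum_{K\in\mathcal{T}_h}\int_{\partial K}\bar q\, v\cdot n\,ds,\qquad \|\bar q\|_p^2=\sum_{F\in\mathcal{F}_h}h_F\int_F\bar q^2\,ds.$$ Fix bases of $V_h$ and $\bar Q_h$, and let $v$, $\bar q$ denote the coefficient vectors of $v_h\in V_h$, $\bar q_h\in\bar Q_h$. Then there are a unique symmetric matrix $D_{uu}$, a unique matrix $B_{\bar pu}$ and a unique symmetric matrix $\bar M$ such that $$d_h(v_h,v_h)=v^TD_{uu}v,\qquad b_2(\bar q_h,v_h)=\bar q^TB_{\bar pu}v,\qquad \|\bar q_h\|_p^2=\bar q^T\bar M\bar q\qquad\text{for all } v_h\in V_h,\ \bar q_h\in\bar Q_h.$$ The matrix $\bar M$ is invertible, and $$D_{uu}=B_{\bar pu}^T\,\bar M^{-1}B_{\bar pu}.$$ -/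

import Mathlib

open MeasureTheory
open scoped RealInnerProductSpace

/-- A (conforming) simplicial mesh in `ℝᵈ`: finitely many nondegenerate `d`-simplices, each given by
its set of `d + 1` vertices, any two of which meet in the convex hull of their common vertices. -/
structure SimplicialMesh (d : ℕ) where
  cells : Finset (Finset (EuclideanSpace ℝ (Fin d)))
  card_cell : ∀ K ∈ cells, K.card = d + 1
  affineIndependent : ∀ K ∈ cells,
    AffineIndependent ℝ ((↑) : K → EuclideanSpace ℝ (Fin d))
  conforming : ∀ K ∈ cells, ∀ L ∈ cells,
    convexHull ℝ (K : Set (EuclideanSpace ℝ (Fin d))) ∩ convexHull ℝ (L : Set _) ⊆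
      convexHull ℝ ((K : Set _) ∩ (L : Set _))

/-- The closed simplex with the given vertices. -/
def simplexHull {d : ℕ} (s : Finset (EuclideanSpace ℝ (Fin d))) :
    Set (EuclideanSpace ℝ (Fin d)) :=
  convexHull ℝ (s : Set (EuclideanSpace ℝ (Fin d)))

/-- The value of a polynomial in `d` variables at a point of `ℝᵈ`. -/
noncomputable def polyValue {d : ℕ} (p : MvPolynomial (Fin d) ℝ)
    (x : EuclideanSpace ℝ (Fin d)) : ℝ :=
  MvPolynomial.eval (fun i => x i) p

/-- `n` is a unit vector orthogonal to `F` that points out of `K` across `F`: the face `F` of `K`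
lies in a hyperplane with normal `n`, and `K` lies in the half space on the side of `-n`. -/
def IsOutwardUnitNormal {d : ℕ} (K F : Finset (EuclideanSpace ℝ (Fin d)))
    (n : EuclideanSpace ℝ (Fin d)) : Prop :=
  ‖n‖ = 1 ∧ (∀ x ∈ simplexHull F, ∀ y ∈ simplexHull F, ⟪n, y - x⟫ = 0) ∧
    ∀ x ∈ simplexHull F, ∀ y ∈ simplexHull K, ⟪n, y - x⟫ ≤ 0

open Classical in
/-- The outward unit normal of the simplex `K` on its facet `F`. -/
noncomputable def outwardNormal {d : ℕ} (K F : Finset (EuclideanSpace ℝ (Fin d))) :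
    EuclideanSpace ℝ (Fin d) :=
  if h : ∃ n, IsOutwardUnitNormal K F n then h.choose else 0

/-- A nondegenerate simplex has an outward unit normal on each of its facets, so that
`outwardNormal` is one. -/
theorem isOutwardUnitNormal_outwardNormal {d : ℕ} (hd : 1 ≤ d)
    {K F : Finset (EuclideanSpace ℝ (Fin d))}
    (hK : AffineIndependent ℝ ((↑) : K → EuclideanSpace ℝ (Fin d)))
    (hKc : K.card = d + 1) (hFK : F ⊆ K) (hF : F.card = d) :
    IsOutwardUnitNormal K F (outwardNormal K F) := by
  classical
  have hex : ∃ n, IsOutwardUnitNormal K F n := by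
    obtain ⟨p, hp⟩ : F.Nonempty := Finset.card_pos.mp (by omega)
    have hdiff : (K \ F).card = 1 := by rw [Finset.card_sdiff_of_subset hFK]; omega
    obtain ⟨a, ha⟩ := Finset.card_eq_one.mp hdiff
    have haKF : a ∈ K \ F := by rw [ha]; exact Finset.mem_singleton_self a
    obtain ⟨haK, haF⟩ := Finset.mem_sdiff.mp haKF
    have hKcases : ∀ y ∈ K, y ∈ F ∨ y = a := by
      intro y hy
      by_cases h : y ∈ F
      · exact Or.inl h
      · right
        have : y ∈ K \ F := Finset.mem_sdiff.mpr ⟨hy, h⟩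
        rw [ha] at this
        exact Finset.mem_singleton.mp this
    set V := vectorSpan ℝ (F : Set (EuclideanSpace ℝ (Fin d))) with hV
    set w := (p - a) - V.starProjection (p - a) with hw
    have hpF : p ∈ affineSpan ℝ (F : Set (EuclideanSpace ℝ (Fin d))) :=
      subset_affineSpan ℝ _ hp
    have hane : a ∉ affineSpan ℝ (F : Set (EuclideanSpace ℝ (Fin d))) := by
      have := hK.notMem_affineSpan_sdiff ⟨a, haK⟩ (Subtype.val ⁻¹' (F : Set _))
      intro hmem
      apply this
      refine affineSpan_mono ℝ ?_ hmem
      intro y hy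
      refine ⟨⟨y, hFK hy⟩, ⟨hy, ?_⟩, rfl⟩
      intro h
      have : y = a := congrArg Subtype.val (Set.mem_singleton_iff.mp h)
      exact haF (this ▸ hy)
    have hw0 : w ≠ 0 := by
      intro h0
      apply hane
      have hmem : p - a ∈ V := by
        rw [sub_eq_zero.mp h0]
        exact Submodule.starProjection_apply_mem _ _
      have h2 : a - p ∈ V := by
        have := V.neg_mem hmem
        rwa [neg_sub] at this
      have h3 : (a - p) +ᵥ p ∈ affineSpan ℝ (F : Set (EuclideanSpace ℝ (Fin d))) :=
        AffineSubspace.vadd_mem_of_mem_direction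
          (by rw [direction_affineSpan]; exact h2) hpF
      simpa using h3
    have horth : ∀ z ∈ V, ⟪w, z⟫ = 0 := by
      intro z hz
      have := Submodule.sub_starProjection_mem_orthogonal (K := V) (p - a)
      rw [real_inner_comm]
      exact (Submodule.mem_orthogonal V _).mp this z hz
    have hwpos : 0 < ‖w‖ := norm_pos_iff.mpr hw0
    have hFspan : ∀ x ∈ simplexHull F, ∀ y ∈ simplexHull F, y - x ∈ V := by
      intro x hx y hy
      have hx' := convexHull_subset_affineSpan (𝕜 := ℝ) _ hx
      have hy' := convexHull_subset_affineSpan (𝕜 := ℝ) _ hy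
      have := AffineSubspace.vsub_mem_direction hy' hx'
      rwa [direction_affineSpan] at this
    have hsub : ∀ y ∈ F, y ∈ simplexHull F := fun y hy => subset_convexHull ℝ _ hy
    have hpa : ⟪w, p - a⟫ = ‖w‖ ^ 2 := by
      have h1 : p - a = w + V.starProjection (p - a) := by rw [hw]; abel
      rw [h1, inner_add_right, horth _ (Submodule.starProjection_apply_mem _ _),
        real_inner_self_eq_norm_sq, add_zero]
    refine ⟨‖w‖⁻¹ • w, ?_, ?_, ?_⟩
    · rw [norm_smul, norm_inv, norm_norm, inv_mul_cancel₀ hwpos.ne']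
    · intro x hx y hy
      rw [real_inner_smul_left, horth _ (hFspan x hx y hy), mul_zero]
    · intro x hx y hy
      rw [real_inner_smul_left]
      refine mul_nonpos_of_nonneg_of_nonpos (inv_nonneg.mpr hwpos.le) ?_
      have hconv : Convex ℝ {y : EuclideanSpace ℝ (Fin d) | ⟪w, y⟫ ≤ ⟪w, x⟫} :=
        convex_halfSpace_le ⟨fun u v => inner_add_right w u v,
          fun c v => by rw [real_inner_smul_right, smul_eq_mul]⟩ _
      have hsubset : simplexHull K ⊆ {y : EuclideanSpace ℝ (Fin d) | ⟪w, y⟫ ≤ ⟪w, x⟫} := by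
        refine convexHull_min ?_ hconv
        intro z hz
        change ⟪w, z⟫ ≤ ⟪w, x⟫
        have hpx := horth _ (hFspan x hx p (hsub p hp))
        rw [inner_sub_right] at hpx hpa
        rcases hKcases z hz with hzF | rfl
        · have := horth _ (hFspan x hx z (hsub z hzF))
          rw [inner_sub_right] at this
          linarith
        · nlinarith [sq_nonneg ‖w‖]
      have := hsubset hy
      rw [inner_sub_right]
      exact sub_nonpos.mpr this
  unfold outwardNormal
  rw [dif_pos hex]
  exact hex.choose_spec

namespace SimplicialMesh

variable {d : ℕ} (T : SimplicialMesh d)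

/-- The domain `Ω`: the open set whose closure is triangulated by the cells. -/
def domain : Set (EuclideanSpace ℝ (Fin d)) :=
  interior (⋃ K ∈ T.cells, simplexHull K)

open Classical in
/-- The faces of the mesh, i.e. all facets of all cells, each given by its `d` vertices. -/
noncomputable def faces : Finset (Finset (EuclideanSpace ℝ (Fin d))) :=
  T.cells.biUnion fun K => K.powersetCard d

/-- The mesh skeleton `Γ⁰`: the union of all faces. -/
def skeleton : Set (EuclideanSpace ℝ (Fin d)) :=
  ⋃ F ∈ T.faces, simplexHull F

/-- The discontinuous cell velocity space
`V_h = {v ∈ L²(Ω)ᵈ : v ∈ P_k(K)ᵈ for all cells K}`. -/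
noncomputable def velocitySpace (k : ℕ) :
    Submodule ℝ (Lp (EuclideanSpace ℝ (Fin d)) 2 (volume.restrict T.domain)) where
  carrier := {v | ∀ K ∈ T.cells, ∃ p : Fin d → MvPolynomial (Fin d) ℝ,
    (∀ i, (p i).totalDegree ≤ k) ∧
      ∀ᵐ x ∂(volume.restrict T.domain), x ∈ simplexHull K → ∀ i, v x i = polyValue (p i) x}
  zero_mem' := by
    intro K _
    refine ⟨fun _ => 0, by simp, ?_⟩
    filter_upwards [Lp.coeFn_zero (EuclideanSpace ℝ (Fin d)) 2 (volume.restrict T.domain)]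
      with x hx _ i
    rw [hx]
    simp [polyValue]
  add_mem' := by
    intro v w hv hw K hK
    obtain ⟨p, hp, hvp⟩ := hv K hK
    obtain ⟨q, hq, hwq⟩ := hw K hK
    refine ⟨fun i => p i + q i, fun i =>
      (MvPolynomial.totalDegree_add _ _).trans (max_le (hp i) (hq i)), ?_⟩
    filter_upwards [Lp.coeFn_add v w, hvp, hwq] with x hx h1 h2 hxK i
    have h1' := h1 hxK i
    have h2' := h2 hxK i
    simp only [polyValue] at h1' h2' ⊢
    rw [hx]
    simp [h1', h2']
  smul_mem' := by
    intro c v hv K hK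
    obtain ⟨p, hp, hvp⟩ := hv K hK
    refine ⟨fun i => c • p i, fun i => (MvPolynomial.totalDegree_smul_le _ _).trans (hp i), ?_⟩
    filter_upwards [Lp.coeFn_smul c v, hvp] with x hx h1 hxK i
    have h1' := h1 hxK i
    simp only [polyValue] at h1' ⊢
    rw [hx]
    simp [h1', MvPolynomial.smul_eval]

/-- The trace pressure space
`Q̄_h = {q ∈ L²(Γ⁰) : q ∈ P_k(F) for all faces F}`, where `Γ⁰` carries the `(d-1)`-dimensional
surface measure. -/
noncomputable def tracePressureSpace (k : ℕ) :
    Submodule ℝ (Lp ℝ 2 ((μHE[d - 1] : Measure (EuclideanSpace ℝ (Fin d))).restrict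
      T.skeleton)) where
  carrier := {q | ∀ F ∈ T.faces, ∃ p : MvPolynomial (Fin d) ℝ, p.totalDegree ≤ k ∧
    ∀ᵐ x ∂((μHE[d - 1] : Measure (EuclideanSpace ℝ (Fin d))).restrict T.skeleton),
      x ∈ simplexHull F → q x = polyValue p x}
  zero_mem' := by
    intro F _
    refine ⟨0, by simp, ?_⟩
    filter_upwards [Lp.coeFn_zero ℝ 2
      ((μHE[d - 1] : Measure (EuclideanSpace ℝ (Fin d))).restrict T.skeleton)] with x hx _
    rw [hx]
    simp [polyValue]
  add_mem' := by
    intro v w hv hw F hF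
    obtain ⟨p, hp, hvp⟩ := hv F hF
    obtain ⟨q, hq, hwq⟩ := hw F hF
    refine ⟨p + q, (MvPolynomial.totalDegree_add _ _).trans (max_le hp hq), ?_⟩
    filter_upwards [Lp.coeFn_add v w, hvp, hwq] with x hx h1 h2 hxF
    have h1' := h1 hxF
    have h2' := h2 hxF
    simp only [polyValue] at h1' h2' ⊢
    rw [hx]
    simp [h1', h2']
  smul_mem' := by
    intro c v hv F hF
    obtain ⟨p, hp, hvp⟩ := hv F hF
    refine ⟨c • p, (MvPolynomial.totalDegree_smul_le _ _).trans hp, ?_⟩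
    filter_upwards [Lp.coeFn_smul c v, hvp] with x hx h1 hxF
    have h1' := h1 hxF
    simp only [polyValue] at h1' ⊢
    rw [hx]
    simp [h1', MvPolynomial.smul_eval]

variable {T} {k : ℕ}

open Classical in
/-- The polynomial vector field that represents `v ∈ V_h` on the cell `K`. It is unique, because
a cell has nonempty interior. -/
noncomputable def cellPolynomial (v : T.velocitySpace k)
    (K : Finset (EuclideanSpace ℝ (Fin d))) : Fin d → MvPolynomial (Fin d) ℝ :=
  if hK : K ∈ T.cells then (v.2 K hK).choose else 0

/-- The trace of `v ∈ V_h` from the interior of the cell `K`, as a function on (the boundary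
of) `K`. -/
noncomputable def cellTrace (v : T.velocitySpace k)
    (K : Finset (EuclideanSpace ℝ (Fin d))) (x : EuclideanSpace ℝ (Fin d)) :
    EuclideanSpace ℝ (Fin d) :=
  WithLp.toLp 2 fun i => polyValue (cellPolynomial v K i) x

open Classical in
/-- The normal jump `⟦v · n⟧` on the face `F`: the sum of `v · n` over the cells that have `F`
as a facet. These are two cells `K⁺, K⁻` on an interior face, where the jump is
`v⁺ · n⁺ + v⁻ · n⁻`, and one cell on a boundary face, where it is `v · n`. -/
noncomputable def normalJump (v : T.velocitySpace k)
    (F : Finset (EuclideanSpace ℝ (Fin d))) (x : EuclideanSpace ℝ (Fin d)) : ℝ :=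
  ∑ K ∈ T.cells with F ⊆ K, ⟪cellTrace v K x, outwardNormal K F⟫

/-- The normal-jump penalty
`d_h(u, v) = ∑_F ∫_F h_F⁻¹ ⟦u · n⟧ ⟦v · n⟧ ds`. -/
noncomputable def jumpPenalty (h : Finset (EuclideanSpace ℝ (Fin d)) → ℝ)
    (u v : T.velocitySpace k) : ℝ :=
  ∑ F ∈ T.faces, ∫ x in simplexHull F,
    (h F)⁻¹ * normalJump u F x * normalJump v F x ∂μHE[d - 1]

/-- The form `b₂(q, v) = ⟨q, v · n⟩_{∂𝒯} = ∑_K ∫_{∂K} q v · n ds`; the boundary of a cell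
consists of its facets. -/
noncomputable def traceDivForm (q : T.tracePressureSpace k) (v : T.velocitySpace k) : ℝ :=
  ∑ K ∈ T.cells, ∑ F ∈ K.powersetCard d, ∫ x in simplexHull F,
    q.1 x * ⟪cellTrace v K x, outwardNormal K F⟫ ∂μHE[d - 1]

/-- The square of the weighted norm, `‖q‖_p² = ∑_F h_F ‖q‖²_F`. -/
noncomputable def tracePressureNormSq (h : Finset (EuclideanSpace ℝ (Fin d)) → ℝ)
    (q : T.tracePressureSpace k) : ℝ :=
  ∑ F ∈ T.faces, h F * ∫ x in simplexHull F, (q.1 x) ^ 2 ∂μHE[d - 1]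

variable {ι κ : Type*} [Fintype ι] [Fintype κ]

/-- `D` is the (symmetric) matrix of the penalty: `d_h(v_h, v_h) = vᵀ D v`, where `v` is the
vector of degrees of freedom of `v_h` in the basis `φ` of `V_h`. -/
def IsPenaltyMatrix (h : Finset (EuclideanSpace ℝ (Fin d)) → ℝ)
    (φ : Module.Basis ι ℝ (T.velocitySpace k)) (D : Matrix ι ι ℝ) : Prop :=
  D.IsSymm ∧ ∀ v : ι → ℝ,
    jumpPenalty h (∑ i, v i • φ i) (∑ i, v i • φ i) = v ⬝ᵥ D.mulVec v

/-- `B` is the matrix of `b₂`: `b₂(q_h, v_h) = qᵀ B v`. -/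
def IsTraceDivMatrix (φ : Module.Basis ι ℝ (T.velocitySpace k))
    (ψ : Module.Basis κ ℝ (T.tracePressureSpace k)) (B : Matrix κ ι ℝ) : Prop :=
  ∀ (q : κ → ℝ) (v : ι → ℝ),
    traceDivForm (∑ i, q i • ψ i) (∑ i, v i • φ i) = q ⬝ᵥ B.mulVec v

/-- `M` is the (symmetric) trace pressure mass matrix: `‖q_h‖_p² = qᵀ M q`. -/
def IsTracePressureMassMatrix (h : Finset (EuclideanSpace ℝ (Fin d)) → ℝ)
    (ψ : Module.Basis κ ℝ (T.tracePressureSpace k)) (M : Matrix κ κ ℝ) : Prop :=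
  M.IsSymm ∧ ∀ q : κ → ℝ,
    tracePressureNormSq h (∑ i, q i • ψ i) = q ⬝ᵥ M.mulVec q

end SimplicialMesh

/-! The weighted jump `J v`, equal to `h_F⁻¹ ⟦v · n⟧` on each face, is itself a trace pressure: the
normals and `h_F` are constant on a face, so the jump is there a polynomial of degree at most `k`.
With the weighted inner product `m(q, r) = ∑_F h_F ∫_F q r`, the weights cancel to give `d_h(u, v) =
m(J u, J v)` and `b₂(q, v) = m(q, J v)`, while `‖q‖_p² = m(q, q)`. In coordinates `B = M J` and `D =
Jᵀ M J`, hence `D = Bᵀ M⁻¹ B`. `M` is invertible because `m` is definite, and the symmetric matrices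
are unique by polarization.

The algebra is `exists_unique_matrices_and_eq`; its hypotheses come from `jumpPenalty_eq_massForm`,
`traceDivForm_eq_massForm` and `eq_zero_of_massForm_self_eq_zero`. The analytic work is to build `J`
as the linear map `jumpPressure`. Faces have finite surface measure, so polynomials are square
integrable on them; by conformity distinct faces meet in null sets, so face-by-face data define a
function almost everywhere on the skeleton; the polynomial of a velocity on a cell is unique, which
makes traces linear. -/

/-! ### Hausdorff measure of the hull of finitely many points -/

section HausdorffMeasureOfHulls

variable {E : Type*} [NormedAddCommGroup E] [NormedSpace ℝ E]

/-- The hull of a nonempty finite set of `m + 1` points is contained in a Lipschitz image of the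
`m`-dimensional unit cube. -/
theorem exists_lipschitzWith_convexHull_subset_image {s : Finset E} {p : E} (hp : p ∈ s) :
    ∃ (t : Finset E) (C : NNReal) (f : (t → ℝ) → E), t.card + 1 = s.card ∧ LipschitzWith C f ∧
      convexHull ℝ (s : Set E) ⊆ f '' Set.Icc 0 1 := by
  classical
  let L : (↥(s.erase p) → ℝ) →L[ℝ] E :=
    ∑ g : ↥(s.erase p), (ContinuousLinearMap.proj (R := ℝ) g).smulRight ((g : E) - p)
  have hL : ∀ x, L x = ∑ g : ↥(s.erase p), x g • ((g : E) - p) := fun x => by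
    simp [L]
  refine ⟨s.erase p, ‖L‖₊, fun x => p + L x, Finset.card_erase_add_one hp, ?_, ?_⟩
  · refine LipschitzWith.of_dist_le_mul fun x y => ?_
    rw [dist_add_left]
    exact L.lipschitz.dist_le_mul x y
  -- The image of the cube is convex and contains the vertices: `0` goes to `p`, and the unit vector
  -- of index `g` goes to `g`.
  · refine convexHull_min ?_ ?_
    · intro y hy
      by_cases h : y = p
      · exact ⟨0, ⟨le_rfl, zero_le_one⟩, by simp [h]⟩
      · have hy' : y ∈ s.erase p := Finset.mem_erase.mpr ⟨h, hy⟩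
        refine ⟨Pi.single ⟨y, hy'⟩ 1, ⟨?_, ?_⟩, ?_⟩
        · exact Pi.single_nonneg.mpr zero_le_one
        · intro i
          by_cases hi : i = ⟨y, hy'⟩
          · subst hi; simp
          · simp [Pi.single_eq_of_ne hi]
        · simp only [hL]
          rw [Finset.sum_eq_single ⟨y, hy'⟩]
          · simp
          · intro b _ hb
            simp [Pi.single_eq_of_ne hb]
          · simp
    · have : (fun x => p + L x) '' Set.Icc 0 1 = (fun z => p + z) '' (L '' Set.Icc 0 1) := by
        rw [Set.image_image]
      rw [this]
      exact ((convex_Icc 0 1).linear_image L.toLinearMap).translate p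

variable [MeasurableSpace E] [BorelSpace E]

/-- A Lipschitz map enlarges the `n`-dimensional Hausdorff measure by at most a constant factor, and
on the `n`-cube that measure is the finite Lebesgue measure. -/
theorem euclideanHausdorffMeasure_convexHull_lt_top {s : Finset E} {n : ℕ}
    (hs : s.card = n + 1) : μHE[n] (convexHull ℝ (s : Set E)) < ⊤ := by
  obtain ⟨p, hp⟩ : s.Nonempty := Finset.card_pos.mp (by omega)
  obtain ⟨t, C, f, ht, hf, hsub⟩ := exists_lipschitzWith_convexHull_subset_image hp
  have hn : (n : ℝ) = Fintype.card t := by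
    rw [Fintype.card_coe]; norm_cast; omega
  have h1 : μH[(n : ℝ)] (convexHull ℝ (s : Set E)) < ⊤ := by
    refine (measure_mono hsub).trans_lt
      ((hf.hausdorffMeasure_image_le (Nat.cast_nonneg n) _).trans_lt ?_)
    rw [hn, hausdorffMeasure_pi_real]
    refine ENNReal.mul_lt_top (by simp) isCompact_Icc.measure_lt_top
  rw [Measure.euclideanHausdorffMeasure_def, Measure.smul_apply, ENNReal.smul_def]
  exact ENNReal.mul_lt_top ENNReal.coe_lt_top h1

/-- Lipschitz maps do not raise Hausdorff dimension, and the covering cube has dimension `s.card - 1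
< n`. -/
theorem euclideanHausdorffMeasure_convexHull_eq_zero {s : Finset E} {n : ℕ}
    (hs : s.card ≤ n) : μHE[n] (convexHull ℝ (s : Set E)) = 0 := by
  rcases s.eq_empty_or_nonempty with rfl | ⟨p, hp⟩
  · simp
  obtain ⟨t, C, f, ht, hf, hsub⟩ := exists_lipschitzWith_convexHull_subset_image hp
  have h1 : μH[((n : NNReal) : ℝ)] (convexHull ℝ (s : Set E)) = 0 := by
    refine hausdorffMeasure_of_dimH_lt ?_
    refine (dimH_mono hsub).trans_lt ((hf.dimH_image_le _).trans_lt
      ((dimH_mono (Set.subset_univ _)).trans_lt ?_))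
    rw [Real.dimH_univ_pi, Fintype.card_coe]
    norm_cast
    omega
  rw [Measure.euclideanHausdorffMeasure_def, Measure.smul_apply]
  simp only [NNReal.coe_natCast] at h1
  rw [h1, smul_zero]

end HausdorffMeasureOfHulls

/-! ### Polynomial functions on Euclidean space -/

section PolyValue

variable {d : ℕ}

theorem polyValue_add (p q : MvPolynomial (Fin d) ℝ) (x : EuclideanSpace ℝ (Fin d)) :
    polyValue (p + q) x = polyValue p x + polyValue q x := by
  simp [polyValue]

theorem polyValue_smul (c : ℝ) (p : MvPolynomial (Fin d) ℝ) (x : EuclideanSpace ℝ (Fin d)) :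
    polyValue (c • p) x = c * polyValue p x := by
  simp [polyValue, MvPolynomial.smul_eval]

theorem polyValue_sum {α : Type*} (s : Finset α) (p : α → MvPolynomial (Fin d) ℝ)
    (x : EuclideanSpace ℝ (Fin d)) :
    polyValue (∑ a ∈ s, p a) x = ∑ a ∈ s, polyValue (p a) x := by
  simp [polyValue]

theorem continuous_polyValue (p : MvPolynomial (Fin d) ℝ) : Continuous (polyValue p) :=
  (MvPolynomial.continuous_eval p).comp (PiLp.continuous_ofLp 2 _)

/-- An open set contains a sup-norm ball, which is a product of infinite sets, and a polynomial is
determined by its values on such a product. -/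
theorem eq_of_polyValue_eq_on_open {p q : MvPolynomial (Fin d) ℝ}
    {U : Set (EuclideanSpace ℝ (Fin d))} (hU : IsOpen U) (hne : U.Nonempty)
    (h : ∀ x ∈ U, polyValue p x = polyValue q x) : p = q := by
  obtain ⟨a, ha⟩ := hne
  have hV : IsOpen {y : Fin d → ℝ | WithLp.toLp 2 y ∈ U} :=
    hU.preimage (PiLp.continuous_toLp 2 _)
  obtain ⟨ε, hε, hball⟩ := Metric.isOpen_iff.mp hV (fun i => a i) (by simpa using ha)
  refine MvPolynomial.funext_set (fun i => Metric.ball (a i) ε) (fun i => ?_) fun y hy => ?_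
  · rw [Real.ball_eq_Ioo]
    exact Set.Ioo_infinite (by linarith)
  · have hy' : y ∈ Metric.ball (fun i => a i) ε := by
      rw [ball_pi _ hε]; exact hy
    exact h _ (hball hy')

end PolyValue

/-! ### Matrices of bilinear and quadratic forms -/

section Matrices

open Matrix LinearMap

variable {ι κ V W : Type*} [Fintype ι] [Fintype κ] [DecidableEq ι] [DecidableEq κ]
  [AddCommGroup V] [Module ℝ V] [AddCommGroup W] [Module ℝ W]

theorem apply_sum_smul_eq_dotProduct_toMatrix₂ (φ : Module.Basis ι ℝ V)
    (ψ : Module.Basis κ ℝ W) (β : V →ₗ[ℝ] W →ₗ[ℝ] ℝ) (v : ι → ℝ) (w : κ → ℝ) :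
    β (∑ i, v i • φ i) (∑ j, w j • ψ j) = v ⬝ᵥ (toMatrix₂ φ ψ β).mulVec w := by
  rw [apply_eq_dotProduct_toMatrix₂_mulVec φ ψ]
  congr 1
  · exact φ.repr_sum_self v
  · congr 1; exact ψ.repr_sum_self w

theorem matrix_eq_of_dotProduct_mulVec_eq {A B : Matrix ι κ ℝ}
    (h : ∀ v w, v ⬝ᵥ A.mulVec w = v ⬝ᵥ B.mulVec w) : A = B := by
  ext i j
  simpa using h (Pi.single i 1) (Pi.single j 1)

theorem Matrix.IsSymm.eq_of_quadratic_eq {A B : Matrix ι ι ℝ} (hA : A.IsSymm) (hB : B.IsSymm)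
    (h : ∀ v, v ⬝ᵥ A.mulVec v = v ⬝ᵥ B.mulVec v) : A = B := by
  have symm : ∀ {C : Matrix ι ι ℝ}, C.IsSymm → ∀ v w, v ⬝ᵥ C.mulVec w = w ⬝ᵥ C.mulVec v := by
    intro C hC v w
    rw [dotProduct_mulVec, dotProduct_comm, ← mulVec_transpose, hC.eq]
  refine matrix_eq_of_dotProduct_mulVec_eq fun v w => ?_
  -- Polarization: by symmetry, expanding at `v + w` isolates twice the mixed term.
  have h1 := h (v + w)
  simp only [mulVec_add, dotProduct_add, add_dotProduct] at h1
  linarith [h v, h w, symm hA v w, symm hB v w]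

theorem isSymm_toMatrix₂ (φ : Module.Basis ι ℝ V) {β : V →ₗ[ℝ] V →ₗ[ℝ] ℝ}
    (hβ : ∀ u v, β u v = β v u) : (toMatrix₂ φ φ β).IsSymm := by
  ext i j
  simp only [transpose_apply, toMatrix₂_apply]
  exact hβ _ _

/-- If a quadratic form `δ` and a pairing `b` are represented by a definite symmetric bilinear form
`m` through a linear map `J`, then their matrices satisfy `D = Bᵀ M⁻¹ B`. -/
theorem exists_unique_matrices_and_eq (φ : Module.Basis ι ℝ V) (ψ : Module.Basis κ ℝ W)
    {m : W →ₗ[ℝ] W →ₗ[ℝ] ℝ} (J : V →ₗ[ℝ] W) {δ : V → V → ℝ} {b : W → V → ℝ} {n : W → ℝ}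
    (hm : ∀ q r, m q r = m r q) (hpos : ∀ q, m q q = 0 → q = 0)
    (hδ : ∀ u, δ u u = m (J u) (J u)) (hb : ∀ q v, b q v = m q (J v)) (hn : ∀ q, n q = m q q) :
    (∃! D : Matrix ι ι ℝ, D.IsSymm ∧ ∀ v : ι → ℝ,
      δ (∑ i, v i • φ i) (∑ i, v i • φ i) = v ⬝ᵥ D.mulVec v) ∧
    (∃! B : Matrix κ ι ℝ, ∀ (q : κ → ℝ) (v : ι → ℝ),
      b (∑ i, q i • ψ i) (∑ i, v i • φ i) = q ⬝ᵥ B.mulVec v) ∧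
    (∃! M : Matrix κ κ ℝ, M.IsSymm ∧ ∀ q : κ → ℝ, n (∑ i, q i • ψ i) = q ⬝ᵥ M.mulVec q) ∧
    ∀ (D : Matrix ι ι ℝ) (B : Matrix κ ι ℝ) (M : Matrix κ κ ℝ),
      (D.IsSymm ∧ ∀ v : ι → ℝ, δ (∑ i, v i • φ i) (∑ i, v i • φ i) = v ⬝ᵥ D.mulVec v) →
      (∀ (q : κ → ℝ) (v : ι → ℝ), b (∑ i, q i • ψ i) (∑ i, v i • φ i) = q ⬝ᵥ B.mulVec v) →
      (M.IsSymm ∧ ∀ q : κ → ℝ, n (∑ i, q i • ψ i) = q ⬝ᵥ M.mulVec q) →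
        IsUnit M.det ∧ D = B.transpose * M⁻¹ * B := by
  -- Each defining property is shown equivalent to equality with an explicit matrix, so existence
  -- and uniqueness become trivial and only one matrix identity is left.
  have hD : ∀ D, (D.IsSymm ∧ ∀ v : ι → ℝ, δ (∑ i, v i • φ i) (∑ i, v i • φ i) =
      v ⬝ᵥ D.mulVec v) ↔
      D = toMatrix₂ φ φ (m.compl₁₂ J J) := by
    have hs : (toMatrix₂ φ φ (m.compl₁₂ J J)).IsSymm := isSymm_toMatrix₂ φ fun u v => hm _ _
    have he : ∀ v : ι → ℝ, δ (∑ i, v i • φ i) (∑ i, v i • φ i) =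
        v ⬝ᵥ (toMatrix₂ φ φ (m.compl₁₂ J J)).mulVec v := fun v => by
      rw [hδ,
        ← apply_sum_smul_eq_dotProduct_toMatrix₂ φ φ]
      rfl
    refine fun D => ⟨fun hD => hD.1.eq_of_quadratic_eq hs fun v => ?_, ?_⟩
    · rw [← hD.2, he]
    · rintro rfl
      exact ⟨hs, he⟩
  have hB : ∀ B, (∀ (q : κ → ℝ) (v : ι → ℝ),
      b (∑ i, q i • ψ i) (∑ i, v i • φ i) = q ⬝ᵥ B.mulVec v) ↔ B = toMatrix₂ ψ φ (m.compl₂ J) := by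
    have he : ∀ (q : κ → ℝ) (v : ι → ℝ),
        b (∑ i, q i • ψ i) (∑ i, v i • φ i) =
        q ⬝ᵥ (toMatrix₂ ψ φ (m.compl₂ J)).mulVec v := fun q v => by
      rw [hb,
        ← apply_sum_smul_eq_dotProduct_toMatrix₂ ψ φ]
      rfl
    refine fun B => ⟨fun hB => matrix_eq_of_dotProduct_mulVec_eq fun q v => ?_, ?_⟩
    · rw [← hB, he]
    · rintro rfl
      exact he
  have hM : ∀ M, (M.IsSymm ∧ ∀ q : κ → ℝ, n (∑ i, q i • ψ i) = q ⬝ᵥ M.mulVec q) ↔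
      M = toMatrix₂ ψ ψ m := by
    have hs : (toMatrix₂ ψ ψ m).IsSymm := isSymm_toMatrix₂ ψ hm
    have he : ∀ q : κ → ℝ, n (∑ i, q i • ψ i) =
        q ⬝ᵥ (toMatrix₂ ψ ψ m).mulVec q := fun q => by
      rw [hn,
        ← apply_sum_smul_eq_dotProduct_toMatrix₂ ψ ψ]
    refine fun M => ⟨fun hM => hM.1.eq_of_quadratic_eq hs fun v => ?_, ?_⟩
    · rw [← hM.2, he]
    · rintro rfl
      exact ⟨hs, he⟩
  simp only [hD, hB, hM]
  refine ⟨existsUnique_eq, existsUnique_eq, existsUnique_eq, ?_⟩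
  rintro _ _ _ rfl rfl rfl
  have hdet : IsUnit (toMatrix₂ ψ ψ m).det := by
    refine ((separatingLeft_iff_det_ne_zero ψ).mp fun q hq => ?_).isUnit
    exact hpos q (hq q)
  refine ⟨hdet, ?_⟩
  have hMs : (toMatrix₂ ψ ψ m)ᵀ = toMatrix₂ ψ ψ m := (isSymm_toMatrix₂ ψ hm).eq
  -- With `J` now the matrix of the map, this is `Jᵀ M J = (M J)ᵀ M⁻¹ (M J)`, using `Mᵀ = M`.
  rw [toMatrix₂_compl₁₂ ψ ψ φ φ, toMatrix₂_compl₂ ψ ψ φ, transpose_mul, hMs, Matrix.mul_assoc,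
    Matrix.mul_assoc, Matrix.mul_assoc, Matrix.nonsing_inv_mul_cancel_left _ _ hdet]

end Matrices

/-! ### Faces of the mesh: null overlaps and finite measure -/

namespace SimplicialMesh

variable {d : ℕ} {T : SimplicialMesh d} {k : ℕ}

theorem mem_faces {F : Finset (EuclideanSpace ℝ (Fin d))} :
    F ∈ T.faces ↔ ∃ K ∈ T.cells, F ⊆ K ∧ F.card = d := by
  simp [faces, Finset.mem_powersetCard]

theorem isCompact_simplexHull (s : Finset (EuclideanSpace ℝ (Fin d))) :
    IsCompact (simplexHull s) :=
  s.finite_toSet.isCompact_convexHull (𝕜 := ℝ)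

theorem simplexHull_subset_skeleton {F : Finset (EuclideanSpace ℝ (Fin d))} (hF : F ∈ T.faces) :
    simplexHull F ⊆ T.skeleton :=
  Set.subset_biUnion_of_mem (u := fun F => simplexHull F) hF

/-- Two faces of the mesh meet in the hull of their common vertices. -/
theorem simplexHull_inter_subset {F G : Finset (EuclideanSpace ℝ (Fin d))} (hF : F ∈ T.faces)
    (hG : G ∈ T.faces) :
    simplexHull F ∩ simplexHull G ⊆
      convexHull ℝ ((F : Set (EuclideanSpace ℝ (Fin d))) ∩ (G : Set _)) := by
  classical
  obtain ⟨K, hK, hFK, -⟩ := mem_faces.mp hF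
  obtain ⟨L, hL, hGL, -⟩ := mem_faces.mp hG
  rintro x ⟨hxF, hxG⟩
  have hx := T.conforming K hK L hL
    ⟨convexHull_mono (Finset.coe_subset.mpr hFK) hxF,
      convexHull_mono (Finset.coe_subset.mpr hGL) hxG⟩
  rw [← Finset.coe_inter] at hx ⊢
  -- `F` and `G` need not be faces of one simplex. Hulls of subsets of an affinely independent set
  -- intersect in the hull of the common points; this is applied inside `K` to cut with `F`, then
  -- inside `L` to cut with `G`.
  have h1 : x ∈ convexHull ℝ ((F ∩ (K ∩ L) : Finset (EuclideanSpace ℝ (Fin d))) : Set _) := by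
    rw [Finset.coe_inter F,
      (T.affineIndependent K hK).convexHull_inter hFK Finset.inter_subset_left]
    exact ⟨hxF, hx⟩
  have h2 : x ∈ convexHull ℝ ((F ∩ (K ∩ L) ∩ G : Finset (EuclideanSpace ℝ (Fin d))) : Set _) := by
    rw [Finset.coe_inter _ G, (T.affineIndependent L hL).convexHull_inter
      (Finset.inter_subset_right.trans Finset.inter_subset_right) hGL]
    exact ⟨h1, hxG⟩
  exact convexHull_mono (Finset.coe_subset.mpr
    (Finset.inter_subset_inter_right Finset.inter_subset_left)) h2

/-- Distinct faces share at most `d - 1` vertices, whose hull has dimension below `d - 1`. -/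
theorem measure_simplexHull_inter_eq_zero (hd : 1 ≤ d)
    {F G : Finset (EuclideanSpace ℝ (Fin d))} (hF : F ∈ T.faces) (hG : G ∈ T.faces)
    (hne : F ≠ G) : μHE[d - 1] (simplexHull F ∩ simplexHull G) = 0 := by
  classical
  refine measure_mono_null (simplexHull_inter_subset hF hG) ?_
  rw [← Finset.coe_inter]
  refine euclideanHausdorffMeasure_convexHull_eq_zero ?_
  obtain ⟨K, hK, hFK, hFc⟩ := mem_faces.mp hF
  obtain ⟨L, hL, hGL, hGc⟩ := mem_faces.mp hG
  have : (F ∩ G).card < F.card := by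
    refine Finset.card_lt_card (Finset.ssubset_iff_subset_ne.mpr ⟨Finset.inter_subset_left, ?_⟩)
    intro h
    exact hne (Finset.eq_of_subset_of_card_le (Finset.inter_eq_left.mp h) (by omega))
  omega

theorem measure_simplexHull_lt_top (hd : 1 ≤ d) {F : Finset (EuclideanSpace ℝ (Fin d))}
    (hF : F ∈ T.faces) : μHE[d - 1] (simplexHull F) < ⊤ := by
  obtain ⟨K, hK, hFK, hFc⟩ := mem_faces.mp hF
  exact euclideanHausdorffMeasure_convexHull_lt_top (by omega)

theorem memLp_face_of_continuous (hd : 1 ≤ d) {F : Finset (EuclideanSpace ℝ (Fin d))}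
    (hF : F ∈ T.faces) {f : EuclideanSpace ℝ (Fin d) → ℝ} (hf : Continuous f) :
    MemLp f 2 ((μHE[d - 1] : Measure (EuclideanSpace ℝ (Fin d))).restrict (simplexHull F)) := by
  obtain ⟨C, hC⟩ := (isCompact_simplexHull F).exists_bound_of_continuousOn hf.continuousOn
  have : IsFiniteMeasure
      ((μHE[d - 1] : Measure (EuclideanSpace ℝ (Fin d))).restrict (simplexHull F)) :=
    ⟨by simpa using measure_simplexHull_lt_top hd hF⟩
  exact MemLp.of_bound hf.aestronglyMeasurable C
    (ae_restrict_of_forall_mem (isCompact_simplexHull F).measurableSet hC)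

/-! ### The polynomial representing a velocity on a cell -/

theorem interior_simplexHull_nonempty {K : Finset (EuclideanSpace ℝ (Fin d))}
    (hK : K ∈ T.cells) : (interior (simplexHull K)).Nonempty := by
  refine interior_convexHull_nonempty_iff_affineSpan_eq_top.mpr ?_
  have h := (T.affineIndependent K hK).affineSpan_eq_top_iff_card_eq_finrank_add_one.mpr
    (by simp [T.card_cell K hK])
  simpa using h

theorem totalDegree_cellPolynomial_le (v : T.velocitySpace k)
    (K : Finset (EuclideanSpace ℝ (Fin d))) (i : Fin d) :
    (cellPolynomial v K i).totalDegree ≤ k := by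
  unfold cellPolynomial
  split_ifs with hK
  · exact (v.2 K hK).choose_spec.1 i
  · simp

theorem ae_eq_cellPolynomial (v : T.velocitySpace k)
    {K : Finset (EuclideanSpace ℝ (Fin d))} (hK : K ∈ T.cells) :
    ∀ᵐ x ∂(volume.restrict T.domain), x ∈ simplexHull K →
      ∀ i, v.1 x i = polyValue (cellPolynomial v K i) x := by
  unfold cellPolynomial
  rw [dif_pos hK]
  exact (v.2 K hK).choose_spec.2

/-- Since `cellPolynomial` is an arbitrary choice, its linearity in `v` rests on this uniqueness:
almost everywhere equality on the interior of `K` becomes equality everywhere by continuity. -/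
theorem cellPolynomial_eq_of_ae_eq (v : T.velocitySpace k)
    {K : Finset (EuclideanSpace ℝ (Fin d))} (hK : K ∈ T.cells)
    {p : Fin d → MvPolynomial (Fin d) ℝ}
    (hp : ∀ᵐ x ∂(volume.restrict T.domain), x ∈ simplexHull K →
      ∀ i, v.1 x i = polyValue (p i) x) : cellPolynomial v K = p := by
  ext1 i
  refine eq_of_polyValue_eq_on_open isOpen_interior (interior_simplexHull_nonempty hK) ?_
  have hsub : interior (simplexHull K) ⊆ T.domain :=
    interior_mono (Set.subset_biUnion_of_mem (u := fun K => simplexHull K) hK)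
  refine Measure.eqOn_open_of_ae_eq (μ := volume) ?_ isOpen_interior
    (continuous_polyValue _).continuousOn (continuous_polyValue _).continuousOn
  filter_upwards [ae_restrict_of_ae_restrict_of_subset hsub hp,
    ae_restrict_of_ae_restrict_of_subset hsub (ae_eq_cellPolynomial v hK),
    ae_restrict_mem isOpen_interior.measurableSet] with x h1 h2 hx
  rw [← h1 (interior_subset hx) i, ← h2 (interior_subset hx) i]

theorem cellPolynomial_add (u v : T.velocitySpace k)
    {K : Finset (EuclideanSpace ℝ (Fin d))} (hK : K ∈ T.cells) :
    cellPolynomial (u + v) K = cellPolynomial u K + cellPolynomial v K := by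
  refine cellPolynomial_eq_of_ae_eq _ hK ?_
  filter_upwards [Lp.coeFn_add u.1 v.1, ae_eq_cellPolynomial u hK, ae_eq_cellPolynomial v hK]
    with x h h1 h2 hx i
  rw [Submodule.coe_add, h, Pi.add_apply, PiLp.add_apply, h1 hx i, h2 hx i, Pi.add_apply,
    polyValue_add]

theorem cellPolynomial_smul (c : ℝ) (v : T.velocitySpace k)
    {K : Finset (EuclideanSpace ℝ (Fin d))} (hK : K ∈ T.cells) :
    cellPolynomial (c • v) K = c • cellPolynomial v K := by
  refine cellPolynomial_eq_of_ae_eq _ hK ?_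
  filter_upwards [Lp.coeFn_smul c v.1, ae_eq_cellPolynomial v hK] with x h h1 hx i
  rw [Submodule.coe_smul, h, Pi.smul_apply, PiLp.smul_apply, h1 hx i, Pi.smul_apply,
    polyValue_smul, smul_eq_mul]

/-! ### The normal jump -/

/-- The polynomial whose values are the normal component of the trace of `v` from the cell `K` on
the face `F`. -/
noncomputable def normalTracePolynomial (v : T.velocitySpace k)
    (K F : Finset (EuclideanSpace ℝ (Fin d))) : MvPolynomial (Fin d) ℝ :=
  ∑ i, outwardNormal K F i • cellPolynomial v K i

theorem polyValue_normalTracePolynomial (v : T.velocitySpace k)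
    (K F : Finset (EuclideanSpace ℝ (Fin d))) (x : EuclideanSpace ℝ (Fin d)) :
    polyValue (normalTracePolynomial v K F) x = ⟪cellTrace v K x, outwardNormal K F⟫ := by
  simp [normalTracePolynomial, polyValue_sum, polyValue_smul, cellTrace, PiLp.inner_apply]

open Classical in
/-- The polynomial whose values are the normal jump of `v` on the face `F`. -/
noncomputable def jumpPolynomial (v : T.velocitySpace k)
    (F : Finset (EuclideanSpace ℝ (Fin d))) : MvPolynomial (Fin d) ℝ :=
  ∑ K ∈ T.cells with F ⊆ K, normalTracePolynomial v K F

theorem polyValue_jumpPolynomial (v : T.velocitySpace k)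
    (F : Finset (EuclideanSpace ℝ (Fin d))) (x : EuclideanSpace ℝ (Fin d)) :
    polyValue (jumpPolynomial v F) x = normalJump v F x := by
  simp [jumpPolynomial, polyValue_sum, polyValue_normalTracePolynomial, normalJump]

theorem totalDegree_jumpPolynomial_le (v : T.velocitySpace k)
    (F : Finset (EuclideanSpace ℝ (Fin d))) : (jumpPolynomial v F).totalDegree ≤ k := by
  unfold jumpPolynomial normalTracePolynomial
  refine MvPolynomial.totalDegree_finsetSum_le fun K _ =>
    MvPolynomial.totalDegree_finsetSum_le fun i _ => ?_
  exact (MvPolynomial.totalDegree_smul_le _ _).trans (totalDegree_cellPolynomial_le v K i)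

theorem jumpPolynomial_add (u v : T.velocitySpace k) (F : Finset (EuclideanSpace ℝ (Fin d))) :
    jumpPolynomial (u + v) F = jumpPolynomial u F + jumpPolynomial v F := by
  unfold jumpPolynomial normalTracePolynomial
  rw [← Finset.sum_add_distrib]
  refine Finset.sum_congr rfl fun K hK => ?_
  rw [cellPolynomial_add u v (Finset.mem_filter.mp hK).1, ← Finset.sum_add_distrib]
  simp only [Pi.add_apply, smul_add]

theorem jumpPolynomial_smul (c : ℝ) (v : T.velocitySpace k)
    (F : Finset (EuclideanSpace ℝ (Fin d))) :
    jumpPolynomial (c • v) F = c • jumpPolynomial v F := by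
  unfold jumpPolynomial normalTracePolynomial
  rw [Finset.smul_sum]
  refine Finset.sum_congr rfl fun K hK => ?_
  rw [cellPolynomial_smul c v (Finset.mem_filter.mp hK).1, Finset.smul_sum]
  simp only [Pi.smul_apply, smul_comm c]

theorem continuous_normalJump (v : T.velocitySpace k) (F : Finset (EuclideanSpace ℝ (Fin d))) :
    Continuous (normalJump v F) :=
  (continuous_polyValue (jumpPolynomial v F)).congr (polyValue_jumpPolynomial v F)

theorem normalJump_add (u v : T.velocitySpace k) (F : Finset (EuclideanSpace ℝ (Fin d)))
    (x : EuclideanSpace ℝ (Fin d)) :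
    normalJump (u + v) F x = normalJump u F x + normalJump v F x := by
  simp only [← polyValue_jumpPolynomial, jumpPolynomial_add, polyValue_add]

theorem normalJump_smul (c : ℝ) (v : T.velocitySpace k) (F : Finset (EuclideanSpace ℝ (Fin d)))
    (x : EuclideanSpace ℝ (Fin d)) : normalJump (c • v) F x = c * normalJump v F x := by
  simp only [← polyValue_jumpPolynomial, jumpPolynomial_smul, polyValue_smul]

/-! ### The weighted jump as a trace pressure -/

/-- The function on the skeleton that equals `h_F⁻¹ ⟦v · n⟧` on each face `F`, up to a null set
where faces meet. -/
noncomputable def weightedJump (h : Finset (EuclideanSpace ℝ (Fin d)) → ℝ)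
    (v : T.velocitySpace k) (x : EuclideanSpace ℝ (Fin d)) : ℝ :=
  ∑ F ∈ T.faces, (simplexHull F).indicator (fun x => (h F)⁻¹ * normalJump v F x) x

variable (h : Finset (EuclideanSpace ℝ (Fin d)) → ℝ)

theorem weightedJump_add (u v : T.velocitySpace k) :
    weightedJump h (u + v) = weightedJump h u + weightedJump h v := by
  ext x
  simp only [weightedJump, Pi.add_apply, ← Finset.sum_add_distrib]
  refine Finset.sum_congr rfl fun F _ => ?_
  by_cases hx : x ∈ simplexHull F <;> simp [hx, normalJump_add, mul_add]

theorem weightedJump_smul (c : ℝ) (v : T.velocitySpace k) :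
    weightedJump h (c • v) = c • weightedJump h v := by
  ext x
  simp only [weightedJump, Pi.smul_apply, Finset.smul_sum]
  refine Finset.sum_congr rfl fun F _ => ?_
  by_cases hx : x ∈ simplexHull F <;> simp [hx, normalJump_smul, mul_left_comm]

theorem memLp_weightedJump (hd : 1 ≤ d) (v : T.velocitySpace k) :
    MemLp (weightedJump h v) 2
      ((μHE[d - 1] : Measure (EuclideanSpace ℝ (Fin d))).restrict T.skeleton) := by
  unfold weightedJump
  refine memLp_finsetSum _ fun F hF => ?_
  rw [memLp_indicator_iff_restrict (isCompact_simplexHull F).measurableSet,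
    Measure.restrict_restrict (isCompact_simplexHull F).measurableSet,
    Set.inter_eq_left.mpr (simplexHull_subset_skeleton hF)]
  exact memLp_face_of_continuous hd hF (continuous_const.mul (continuous_normalJump v F))

/-- Off the null set where `F` meets other faces, only the indicator of `F` survives in the sum. -/
theorem ae_weightedJump_eq (hd : 1 ≤ d) (v : T.velocitySpace k)
    {F : Finset (EuclideanSpace ℝ (Fin d))} (hF : F ∈ T.faces) :
    ∀ᵐ x ∂(μHE[d - 1] : Measure (EuclideanSpace ℝ (Fin d))), x ∈ simplexHull F →
      weightedJump h v x = (h F)⁻¹ * normalJump v F x := by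
  have hnull : ∀ᵐ x ∂(μHE[d - 1] : Measure (EuclideanSpace ℝ (Fin d))),
      ∀ G ∈ T.faces, G ≠ F → x ∉ simplexHull F ∩ simplexHull G := by
    refine (Filter.eventually_all_finset _).mpr fun G hG => ?_
    by_cases hGF : G = F
    · exact Filter.Eventually.of_forall fun x hx => absurd hGF hx
    · filter_upwards [measure_eq_zero_iff_ae_notMem.mp
        (measure_simplexHull_inter_eq_zero hd hF hG (Ne.symm hGF))] with x hx _ using hx
  filter_upwards [hnull] with x hx hxF
  unfold weightedJump
  rw [Finset.sum_eq_single_of_mem F hF fun G hG hGF =>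
    Set.indicator_of_notMem (fun hxG => hx G hG hGF ⟨hxF, hxG⟩) _, Set.indicator_of_mem hxF]

/-- The map taking `v` to the trace pressure `h_F⁻¹ ⟦v · n⟧`. -/
noncomputable def jumpPressure (hd : 1 ≤ d) : T.velocitySpace k →ₗ[ℝ] T.tracePressureSpace k where
  toFun v := ⟨(memLp_weightedJump h hd v).toLp _, fun F hF =>
    ⟨(h F)⁻¹ • jumpPolynomial v F,
      (MvPolynomial.totalDegree_smul_le _ _).trans (totalDegree_jumpPolynomial_le v F), by
      filter_upwards [(memLp_weightedJump h hd v).coeFn_toLp,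
        ae_restrict_of_ae (ae_weightedJump_eq h hd v hF)] with x h1 h2 hx
      rw [h1, h2 hx, polyValue_smul, polyValue_jumpPolynomial]⟩⟩
  map_add' u v := by
    ext1
    simp only [weightedJump_add, Submodule.coe_add]
    exact MemLp.toLp_add _ _
  map_smul' c v := by
    ext1
    simp only [weightedJump_smul, Submodule.coe_smul, RingHom.id_apply]
    exact MemLp.toLp_const_smul _ _

theorem ae_jumpPressure_eq (hd : 1 ≤ d) (v : T.velocitySpace k)
    {F : Finset (EuclideanSpace ℝ (Fin d))} (hF : F ∈ T.faces) :
    ∀ᵐ x ∂(μHE[d - 1] : Measure (EuclideanSpace ℝ (Fin d))).restrict (simplexHull F),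
      (jumpPressure h hd v).1 x = (h F)⁻¹ * normalJump v F x := by
  filter_upwards [ae_restrict_of_ae_restrict_of_subset (simplexHull_subset_skeleton hF)
      (memLp_weightedJump h hd v).coeFn_toLp, ae_restrict_of_ae (ae_weightedJump_eq h hd v hF),
    ae_restrict_mem (isCompact_simplexHull F).measurableSet] with x h1 h2 hx
  exact h1.trans (h2 hx)

/-! ### The mass form -/

theorem memLp_face (q : T.tracePressureSpace k) {F : Finset (EuclideanSpace ℝ (Fin d))}
    (hF : F ∈ T.faces) :
    MemLp q.1 2 ((μHE[d - 1] : Measure (EuclideanSpace ℝ (Fin d))).restrict (simplexHull F)) :=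
  (Lp.memLp q.1).mono_measure (Measure.restrict_mono (simplexHull_subset_skeleton hF) le_rfl)

theorem integrable_mul_face (q r : T.tracePressureSpace k)
    {F : Finset (EuclideanSpace ℝ (Fin d))} (hF : F ∈ T.faces) :
    Integrable (fun x => q.1 x * r.1 x)
      ((μHE[d - 1] : Measure (EuclideanSpace ℝ (Fin d))).restrict (simplexHull F)) :=
  (memLp_face q hF).integrable_mul (memLp_face r hF)

theorem ae_face_add (q r : T.tracePressureSpace k) {F : Finset (EuclideanSpace ℝ (Fin d))}
    (hF : F ∈ T.faces) :
    ∀ᵐ x ∂(μHE[d - 1] : Measure (EuclideanSpace ℝ (Fin d))).restrict (simplexHull F),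
      (q + r).1 x = q.1 x + r.1 x :=
  ae_restrict_of_ae_restrict_of_subset (simplexHull_subset_skeleton hF) (Lp.coeFn_add q.1 r.1)

theorem ae_face_smul (c : ℝ) (q : T.tracePressureSpace k)
    {F : Finset (EuclideanSpace ℝ (Fin d))} (hF : F ∈ T.faces) :
    ∀ᵐ x ∂(μHE[d - 1] : Measure (EuclideanSpace ℝ (Fin d))).restrict (simplexHull F),
      (c • q).1 x = c * q.1 x :=
  ae_restrict_of_ae_restrict_of_subset (simplexHull_subset_skeleton hF) (Lp.coeFn_smul c q.1)

/-- The weighted inner product `∑_F h_F ∫_F q r` of trace pressures. -/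
noncomputable def massForm :
    T.tracePressureSpace k →ₗ[ℝ] T.tracePressureSpace k →ₗ[ℝ] ℝ := by
  refine LinearMap.mk₂ ℝ
    (fun q r => ∑ F ∈ T.faces, h F * ∫ x in simplexHull F, q.1 x * r.1 x ∂μHE[d - 1])
    (fun q q' r => ?_) (fun c q r => ?_) (fun q r r' => ?_) (fun c q r => ?_)
  · rw [← Finset.sum_add_distrib]
    refine Finset.sum_congr rfl fun F hF => ?_
    rw [← mul_add, ← integral_add (integrable_mul_face q r hF) (integrable_mul_face q' r hF)]
    congr 1
    refine integral_congr_ae ?_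
    filter_upwards [ae_face_add q q' hF] with x hx
    rw [hx, add_mul]
  · rw [Finset.smul_sum]
    refine Finset.sum_congr rfl fun F hF => ?_
    rw [smul_eq_mul, mul_left_comm c]
    congr 1
    rw [← integral_const_mul]
    refine integral_congr_ae ?_
    filter_upwards [ae_face_smul c q hF] with x hx
    rw [hx, mul_assoc]
  · rw [← Finset.sum_add_distrib]
    refine Finset.sum_congr rfl fun F hF => ?_
    rw [← mul_add, ← integral_add (integrable_mul_face q r hF) (integrable_mul_face q r' hF)]
    congr 1
    refine integral_congr_ae ?_
    filter_upwards [ae_face_add r r' hF] with x hx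
    rw [hx, mul_add]
  · rw [Finset.smul_sum]
    refine Finset.sum_congr rfl fun F hF => ?_
    rw [smul_eq_mul, mul_left_comm c]
    congr 1
    rw [← integral_const_mul]
    refine integral_congr_ae ?_
    filter_upwards [ae_face_smul c r hF] with x hx
    rw [hx, mul_left_comm]

theorem massForm_apply (q r : T.tracePressureSpace k) :
    massForm h q r =
      ∑ F ∈ T.faces, h F * ∫ x in simplexHull F, q.1 x * r.1 x ∂μHE[d - 1] :=
  rfl

theorem massForm_comm (q r : T.tracePressureSpace k) : massForm h q r = massForm h r q := by
  simp only [massForm_apply, mul_comm]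

theorem tracePressureNormSq_eq_massForm (q : T.tracePressureSpace k) :
    tracePressureNormSq h q = massForm h q q := by
  simp only [tracePressureNormSq, massForm_apply, sq]

variable {h}

theorem eq_zero_of_massForm_self_eq_zero (hh : ∀ F ∈ T.faces, 0 < h F)
    {q : T.tracePressureSpace k} (hq : massForm h q q = 0) : q = 0 := by
  rw [massForm_apply, Finset.sum_eq_zero_iff_of_nonneg fun F hF => mul_nonneg (hh F hF).le
    (integral_nonneg fun x => mul_self_nonneg _)] at hq
  have hface : ∀ F ∈ T.faces, ∀ᵐ x ∂(μHE[d - 1] : Measure (EuclideanSpace ℝ (Fin d))).restrict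
      (simplexHull F), q.1 x = 0 := by
    intro F hF
    have h0 := (mul_eq_zero.mp (hq F hF)).resolve_left (hh F hF).ne'
    rw [integral_eq_zero_iff_of_nonneg (fun x => mul_self_nonneg _)
      (integrable_mul_face q q hF)] at h0
    filter_upwards [h0] with x hx using mul_self_eq_zero.mp hx
  ext1
  refine (Lp.eq_zero_iff_ae_eq_zero (f := q.1)).mpr ?_
  -- The skeleton is a finite union of faces, so vanishing almost everywhere on each face suffices.
  refine (ae_restrict_biUnion_finset_iff _ _ _).mpr hface

theorem jumpPenalty_eq_massForm (hd : 1 ≤ d) (hh : ∀ F ∈ T.faces, 0 < h F)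
    (u v : T.velocitySpace k) :
    jumpPenalty h u v = massForm h (jumpPressure h hd u) (jumpPressure h hd v) := by
  rw [jumpPenalty, massForm_apply]
  refine Finset.sum_congr rfl fun F hF => ?_
  rw [← integral_const_mul]
  refine integral_congr_ae ?_
  filter_upwards [ae_jumpPressure_eq h hd u hF, ae_jumpPressure_eq h hd v hF] with x h1 h2
  have := (hh F hF).ne'
  rw [h1, h2]
  field_simp

/-- Regrouping the sum over cell boundaries by faces collects, on each face, the normal traces from
all adjacent cells, which is the jump; the weight `h_F` cancels the `h_F⁻¹` in `jumpPressure`. -/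
theorem traceDivForm_eq_massForm (hd : 1 ≤ d) (hh : ∀ F ∈ T.faces, 0 < h F)
    (q : T.tracePressureSpace k) (v : T.velocitySpace k) :
    traceDivForm q v = massForm h q (jumpPressure h hd v) := by
  classical
  have hswap : traceDivForm q v = ∑ F ∈ T.faces, ∑ K ∈ T.cells with F ⊆ K,
      ∫ x in simplexHull F, q.1 x * ⟪cellTrace v K x, outwardNormal K F⟫ ∂μHE[d - 1] := by
    refine Finset.sum_comm' fun K F => ?_
    simp only [Finset.mem_powersetCard, Finset.mem_filter, mem_faces]
    exact ⟨fun ⟨hK, hF, hc⟩ => ⟨⟨hK, hF⟩, K, hK, hF, hc⟩,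
      fun ⟨⟨hK, hF⟩, _, _, _, hc⟩ => ⟨hK, hF, hc⟩⟩
  rw [hswap, massForm_apply]
  refine Finset.sum_congr rfl fun F hF => ?_
  rw [← integral_finsetSum, ← integral_const_mul]
  · refine integral_congr_ae ?_
    filter_upwards [ae_jumpPressure_eq h hd v hF] with x hx
    rw [hx, ← Finset.mul_sum, mul_left_comm (q.1 x), mul_inv_cancel_left₀ (hh F hF).ne']
    rfl
  · intro K _
    refine (memLp_face q hF).integrable_mul (memLp_face_of_continuous hd hF ?_)
    exact (continuous_polyValue (normalTracePolynomial v K F)).congr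
      (polyValue_normalTracePolynomial v K F)

end SimplicialMesh

theorem mainTheorem3 {d : ℕ} (hd : 2 ≤ d) (T : SimplicialMesh d) (k : ℕ)
    (h : Finset (EuclideanSpace ℝ (Fin d)) → ℝ) (hh : ∀ F ∈ T.faces, 0 < h F)
    {ι κ : Type*} [Fintype ι] [DecidableEq ι] [Fintype κ] [DecidableEq κ]
    (φ : Module.Basis ι ℝ (T.velocitySpace k))
    (ψ : Module.Basis κ ℝ (T.tracePressureSpace k)) :
    (∃! D : Matrix ι ι ℝ, SimplicialMesh.IsPenaltyMatrix h φ D) ∧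
    (∃! B : Matrix κ ι ℝ, SimplicialMesh.IsTraceDivMatrix φ ψ B) ∧
    (∃! M : Matrix κ κ ℝ, SimplicialMesh.IsTracePressureMassMatrix h ψ M) ∧
    ∀ (D : Matrix ι ι ℝ) (B : Matrix κ ι ℝ) (M : Matrix κ κ ℝ),
      SimplicialMesh.IsPenaltyMatrix h φ D →
      SimplicialMesh.IsTraceDivMatrix φ ψ B →
      SimplicialMesh.IsTracePressureMassMatrix h ψ M →
        IsUnit M.det ∧ D = B.transpose * M⁻¹ * B := by
  have hd1 : 1 ≤ d := by omega
  exact exists_unique_matrices_and_eq φ ψ (SimplicialMesh.jumpPressure h hd1)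
    (SimplicialMesh.massForm_comm h)
    (fun _ hq => SimplicialMesh.eq_zero_of_massForm_self_eq_zero hh hq)
    (fun u => SimplicialMesh.jumpPenalty_eq_massForm hd1 hh u u)
    (SimplicialMesh.traceDivForm_eq_massForm hd1 hh)
    (SimplicialMesh.tracePressureNormSq_eq_massForm h)
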